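/- Let $p\in(0,1)\setminus\{1/2\}$, $q\in[0,1]$, $f:[0,1]\to[0,1]$ and put $g(x)=pf(x)+(1-p)\{1-f(x)\}$ for $x\in[0,1]$. Let $k(n)\in\{1,\dots,n\}$, $n\ge 1$, be non-decreasing in $n$ with $k(n)\to\infty$. Consider the $\pm1$-valued steps $X_1,X_2,\dots$ with $S_n=X_1+\cdots+X_n$, defined as follows: $X_1$ equals $1$ with probability $q$ and $-1$ with probability $1-q$; for each $n\ge1$, conditionally on the $\sigma$-field $\mathcal F_n$ of all information up to and including time $n$, $(U_{n,1},\dots,U_{n,k(n)})$ is uniformly distributed over all ordered $k(n)$-tuples of distinct elements of $\{1,\dots,n\}$ (sampling without replacement); and, conditionally on $\mathcal F_n$ and on this sample, $X_{n+1}$ equals $1$ with probability $g(C_n^+/k(n))$ and $-1$ with probability $1-g(C_n^+/k(n))$, where $C_n^+=\#\{i: X_{U_{n,i}}=1\}$. Consider the conditions (F1) $f\in\mathcal C^0[0,1]$ and $\sum_{n\ge1}\frac1{n+1}\sup\{|f(x)-f(y)|:x,y\in[0,1],|x-y|<k(n)^{-1/2}\}<\infty$; (F2) for some $0<\alpha\le1$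 and some $L$, $|f(x)-f(y)|\le L|x-y|^\alpha$ for all $x,y\in[0,1]$, and $\sum_{n\ge1}(n+1)^{-1}k(n)^{-\alpha/2}<\infty$; (F3) $f\in\mathcal C^1[0,1]$ and $\sum_{n\ge1}\frac1{(n+1)\sqrt{k(n)}}\sup\{|f'(x)-f'(y)|:x,y\in[0,1],|x-y|<k(n)^{-1/2}\}<\infty$; (F4) $f\in\mathcal C^2[0,1]$ and $\sum_{n\ge1}(n+1)^{-1}k(n)^{-1}<\infty$. Assume that either one of (F1), (F3) holds together with $\sum_{n\ge1}(n+1)^{-2}k(n)^{-2}<\infty$, or one of (F2), (F4) holds. Then: (i) if $g$ has a unique fixed point $x^*$ in $[0,1]$ and $\{g(x)-x\}(x-x^*)<0$ for all $x\in[0,1]\setminus\{x^*\}$, then $S_n/n\to 2x^*-1$ almost surely; (ii) in particular, if $g$ has a unique fixed point $x^*$ in $[0,1]$, then $S_n/n\to 2x^*-1$ almost surely; (iii) even more specifically, $g$ has a unique fixed point $x^*$ in $[0,1]$ and $S_n/n\to 2x^*-1$ almost surely whenever one of the following holds: (G1) $f\in\mathcal C^1[0,1]$, and either $p\in(1/2,1)$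 and $f$ is strictly decreasing on $[0,1]$, or $p\in(0,1/2)$ and $f$ is strictly increasing on $[0,1]$; (G2) $f\in\mathcal C^2[0,1]$, and $f$ is either strictly convex throughout $(0,1)$ or strictly concave throughout $(0,1)$; (G3) for some $c$ with $c|2p-1|<1$, $|f(x)-f(y)|\le c|x-y|$ for all $x,y\in[0,1]$. -/

import Mathlib

open MeasureTheory ProbabilityTheory Filter Topology Set

noncomputable section

namespace Elephant

/-- The probability that the next step is `+1` when the proportion of `+1`s in the sample is `x`;
as a function on `[0,1]` this is the function `g`. -/
def g (p : ℝ) (f : ℝ → ℝ) (x : ℝ) : ℝ := p * f x + (1 - p) * (1 - f x)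

/-- The number `C_n^+` of `+1`-valued steps among the sampled time-stamps `u 0, …, u (k - 1)`,
along the trajectory `x`. -/
def plusCount {k : ℕ} (x : ℕ → ℝ) (u : Fin k → ℕ) : ℕ :=
  (Finset.univ.filter fun i => x (u i) = 1).card

/-- The position `S_n = X_1 + ⋯ + X_n` of the walk. -/
def position {Ω : Type*} (X : ℕ → Ω → ℝ) (n : ℕ) (ω : Ω) : ℝ :=
  ∑ i ∈ Finset.Icc 1 n, X i ω

/-- The walk in which, at time `n + 1`, a sample `U n = (U_{n,1}, …, U_{n,k(n)})` of size `k n` is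
drawn without replacement from the past time-stamps `1, …, n`, with memory parameter `p`,
first-step parameter `q` and reinforcement function `f`. The `σ`-algebra `ℱ n` is the information
up to and including time `n`. -/
structure IsWalkWithoutReplacement {Ω : Type*} {mΩ : MeasurableSpace Ω} (μ : Measure Ω)
    (p q : ℝ) (f : ℝ → ℝ) (k : ℕ → ℕ) (ℱ : Filtration ℕ mΩ)
    (X : ℕ → Ω → ℝ) (U : (n : ℕ) → Ω → Fin (k n) → ℕ) : Prop where
  adapted : ∀ n, Measurable[ℱ n] (X n)
  measurable_sample : ∀ n, 1 ≤ n → Measurable (U n)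
  zero : ∀ ω, X 0 ω = 0
  /-- The first step is Rademacher with parameter `q`. -/
  first_plus : μ {ω | X 1 ω = 1} = ENNReal.ofReal q
  first_minus : μ {ω | X 1 ω = -1} = ENNReal.ofReal (1 - q)
  /-- Given `ℱ n`, the sample is uniform over the ordered `k n`-tuples of distinct elements of
  `{1, …, n}`. -/
  sample_law : ∀ n, 1 ≤ n → ∀ u : Fin (k n) → ℕ, Function.Injective u →
    (∀ i, u i ∈ Finset.Icc 1 n) →
    μ⟦{ω | U n ω = u} | ℱ n⟧ =ᵐ[μ] fun _ => ((n.choose (k n) * (k n).factorial : ℕ) : ℝ)⁻¹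
  /-- The conditional law of the step at time `n + 1` given `ℱ n` and the sample. -/
  step_plus : ∀ n, 1 ≤ n →
    μ⟦{ω | X (n + 1) ω = 1} | ℱ n ⊔ MeasurableSpace.comap (U n) inferInstance⟧ =ᵐ[μ]
      fun ω =>
        p * f ((plusCount (fun j => X j ω) (U n ω) : ℝ) / (k n : ℝ)) +
          (1 - p) * (1 - f ((plusCount (fun j => X j ω) (U n ω) : ℝ) / (k n : ℝ)))
  step_minus : ∀ n, 1 ≤ n →
    μ⟦{ω | X (n + 1) ω = -1} | ℱ n ⊔ MeasurableSpace.comap (U n) inferInstance⟧ =ᵐ[μ]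
      fun ω =>
        (1 - p) * f ((plusCount (fun j => X j ω) (U n ω) : ℝ) / (k n : ℝ)) +
          p * (1 - f ((plusCount (fun j => X j ω) (U n ω) : ℝ) / (k n : ℝ)))

/-- The modulus of continuity `sup {|φ x - φ y| : x, y ∈ [0,1], |x - y| < δ}`. -/
def modulus (φ : ℝ → ℝ) (δ : ℝ) : ℝ :=
  sSup {r | ∃ x ∈ Icc (0 : ℝ) 1, ∃ y ∈ Icc (0 : ℝ) 1, |x - y| < δ ∧ r = |φ x - φ y|}

/-! In the series below all terms are nonnegative, so convergence is summability; the term with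
index `0` has no influence on it. -/

/-- `f` is continuous, with a summability condition on its modulus of continuity. -/
def CondF1 (f : ℝ → ℝ) (k : ℕ → ℕ) : Prop :=
  ContinuousOn f (Icc 0 1) ∧
    Summable fun n : ℕ => 1 / ((n : ℝ) + 1) * modulus f ((k n : ℝ) ^ (-(1 / 2) : ℝ))

/-- `f` is Hölder continuous, with a summability condition involving the exponent. -/
def CondF2 (f : ℝ → ℝ) (k : ℕ → ℕ) : Prop :=
  ∃ α L : ℝ, 0 < α ∧ α ≤ 1 ∧
    (∀ x ∈ Icc (0 : ℝ) 1, ∀ y ∈ Icc (0 : ℝ) 1, |f x - f y| ≤ L * |x - y| ^ α) ∧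
    Summable fun n : ℕ => ((n : ℝ) + 1)⁻¹ * (k n : ℝ) ^ (-(α / 2))

/-- `f` is continuously differentiable on `[0,1]`, with a summability condition on the modulus of
continuity of its derivative. -/
def CondF3 (f : ℝ → ℝ) (k : ℕ → ℕ) : Prop :=
  ContDiffOn ℝ 1 f (Icc 0 1) ∧
    Summable fun n : ℕ => 1 / (((n : ℝ) + 1) * √(k n : ℝ)) *
      modulus (derivWithin f (Icc 0 1)) ((k n : ℝ) ^ (-(1 / 2) : ℝ))

/-- `f` is twice continuously differentiable on `[0,1]`, and `∑ (n+1)⁻¹ k(n)⁻¹` converges. -/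
def CondF4 (f : ℝ → ℝ) (k : ℕ → ℕ) : Prop :=
  ContDiffOn ℝ 2 f (Icc 0 1) ∧ Summable fun n : ℕ => ((n : ℝ) + 1)⁻¹ * (k n : ℝ)⁻¹

/-- Convergence of `∑ (n+1)⁻² k(n)⁻²`. -/
def CondSquares (k : ℕ → ℕ) : Prop :=
  Summable fun n : ℕ => (((n : ℝ) + 1) ^ 2)⁻¹ * ((k n : ℝ) ^ 2)⁻¹

/-- Monotonicity against the sign of `p - 1/2`. -/
def CondG1 (p : ℝ) (f : ℝ → ℝ) : Prop :=
  ContDiffOn ℝ 1 f (Icc 0 1) ∧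
    ((1 / 2 < p ∧ p < 1 ∧ StrictAntiOn f (Icc 0 1)) ∨
      (0 < p ∧ p < 1 / 2 ∧ StrictMonoOn f (Icc 0 1)))

/-- Strict convexity or strict concavity. -/
def CondG2 (f : ℝ → ℝ) : Prop :=
  ContDiffOn ℝ 2 f (Icc 0 1) ∧ (StrictConvexOn ℝ (Ioo 0 1) f ∨ StrictConcaveOn ℝ (Ioo 0 1) f)

/-- A Lipschitz bound that makes `g` a contraction. -/
def CondG3 (p : ℝ) (f : ℝ → ℝ) : Prop :=
  ∃ c : ℝ, (∀ x ∈ Icc (0 : ℝ) 1, ∀ y ∈ Icc (0 : ℝ) 1, |f x - f y| ≤ c * |x - y|) ∧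
    c * |2 * p - 1| < 1

/-- `xs` is the only fixed point of `φ` in `[0,1]`. -/
def IsUniqueFixedPoint (φ : ℝ → ℝ) (xs : ℝ) : Prop :=
  xs ∈ Icc (0 : ℝ) 1 ∧ φ xs = xs ∧ ∀ y ∈ Icc (0 : ℝ) 1, φ y = y → y = xs

/-- `S_n / n → 2 xs - 1` almost surely. -/
def ConvergesTo {Ω : Type*} {mΩ : MeasurableSpace Ω} (μ : Measure Ω) (X : ℕ → Ω → ℝ)
    (xs : ℝ) : Prop :=
  ∀ᵐ ω ∂μ, Tendsto (fun n : ℕ => position X n ω / (n : ℝ)) atTop (𝓝 (2 * xs - 1))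

end Elephant

end

/-! ### Perturbed recursions on the unit interval -/

namespace Elephant

/-! Let `θ n` be the proportion of `+1`s among the first `n` steps, so `S_n / n = 2 θ n - 1` almost
surely. With `Y` the indicator of a `+1`-step, `θ (n+1) = θ n + (Y (n+1) - θ n) / (n+1)`.
Conditioning on the past splits `Y (n+1) - θ n` into the drift `g (θ n) - θ n`, a bias, and a
martingale difference.

The weighted martingale differences sum to an `L²`-bounded martingale, since `∑ (n+1)⁻²` converges;
hence they converge almost surely (`ae_exists_tendsto_sum_centred`). The bias is the average of `g`
over sampled proportions minus `g (θ n)`. A sample of size `k` drawn without replacement has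
proportion variance at most `1 / k`, so Bernstein's argument and uniform continuity make the bias
vanish uniformly over trajectories (`abs_average_sub_le`). No rate is needed: when the drift points
to `x*`, a vanishing bias cannot overcome it away from `x*`, and divergence of `∑ (n+1)⁻¹` forces `θ
n → x*` (`tendsto_of_perturbed_recursion`).

For a unique fixed point the sign of the drift follows from the intermediate value theorem
(`IsUniqueFixedPoint.drift_neg`). The shape conditions give uniqueness through monotonicity,
convexity or contraction (`fixedPoint_unique`). -/

/-- A recursion whose drift is bounded below by a positive constant whenever it is below the
level `l` eventually stays above every lower level, provided that the step sizes tend to zero and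
are not summable. -/
theorem eventually_ge_of_drift {z a d : ℕ → ℝ} {l c B η : ℝ}
    (hrec : ∀ᶠ n in atTop, z (n + 1) = z n + a n * d n)
    (ha : ∀ n, 0 ≤ a n) (ha0 : Tendsto a atTop (𝓝 0))
    (hasum : Tendsto (fun n => ∑ i ∈ Finset.range n, a i) atTop atTop)
    (hB : ∀ᶠ n in atTop, |d n| ≤ B) (hc : 0 < c)
    (hd : ∀ᶠ n in atTop, z n ≤ l → c ≤ d n) (hη : 0 < η) :
    ∀ᶠ n in atTop, l - η ≤ z n := by
  have hsmall : ∀ᶠ n in atTop, a n * B < η := by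
    have : Tendsto (fun n => a n * B) atTop (𝓝 (0 * B)) := ha0.mul_const B
    rw [zero_mul] at this
    exact this.eventually_lt_const hη
  obtain ⟨N, hN⟩ := eventually_atTop.1 (hrec.and (hB.and (hd.and hsmall)))
  -- Staying below `l` forever would add at least `c * a n` at every step, and `∑ a n` diverges.
  have hit : ∃ m, N ≤ m ∧ l < z m := by
    by_contra! hcon
    have hlow : ∀ j, z N + c * ((∑ i ∈ Finset.range (N + j), a i) -
        ∑ i ∈ Finset.range N, a i) ≤ z (N + j) := by
      intro j
      induction j with
      | zero => simp
      | succ j ih =>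
        obtain ⟨h1, -, h3, -⟩ := hN (N + j) (by omega)
        have h4 := h3 (hcon _ (by omega))
        have h5 := mul_le_mul_of_nonneg_left h4 (ha (N + j))
        rw [← add_assoc, h1, Finset.sum_range_succ]
        linarith
    have ht : Tendsto (fun j => ∑ i ∈ Finset.range (N + j), a i) atTop atTop :=
      hasum.comp (tendsto_add_atTop_nat N |>.congr fun j => add_comm _ _)
    obtain ⟨j, hj⟩ := (ht.eventually_gt_atTop
      ((l - z N) / c + ∑ i ∈ Finset.range N, a i)).exists
    have h1 := hlow j
    have h2 := hcon (N + j) (by omega)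
    have h3 : (l - z N) / c < (∑ i ∈ Finset.range (N + j), a i) -
        ∑ i ∈ Finset.range N, a i := by linarith
    rw [div_lt_iff₀ hc] at h3
    linarith
  obtain ⟨m, hNm, hm⟩ := hit
  -- From then on `l - η` is a barrier: below `l` the sequence does not decrease, and from above `l`
  -- one step loses at most `a n * B < η`.
  refine eventually_atTop.2 ⟨m, fun n hn => ?_⟩
  induction n, hn using Nat.le_induction with
  | base => linarith
  | succ n hn ih =>
    obtain ⟨h1, h2, h3, h4⟩ := hN n (by omega)
    rw [h1]
    rcases le_or_gt (z n) l with h | h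
    · have := mul_nonneg (ha n) (hc.le.trans (h3 h))
      linarith
    · have h5 : a n * (-d n) ≤ a n * B :=
        mul_le_mul_of_nonneg_left ((neg_le_abs _).trans h2) (ha n)
      linarith

/-- Deterministic convergence of a perturbed recursion on `[0,1]` with drift `h` pointing towards
`xs`, a vanishing bias `e` and a convergent noise series `w`. -/
theorem tendsto_of_perturbed_recursion {x e w a : ℕ → ℝ} {h : ℝ → ℝ} {xs w' : ℝ}
    (hx : ∀ n, x n ∈ Icc (0 : ℝ) 1) (hcont : ContinuousOn h (Icc 0 1))
    (hsign : ∀ y ∈ Icc (0 : ℝ) 1, y ≠ xs → h y * (y - xs) < 0)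
    (hrec : ∀ᶠ n in atTop, x (n + 1) = x n + a n * (h (x n) + e n) + (w (n + 1) - w n))
    (ha : ∀ n, 0 ≤ a n) (ha0 : Tendsto a atTop (𝓝 0))
    (hasum : Tendsto (fun n => ∑ i ∈ Finset.range n, a i) atTop atTop)
    (he : Tendsto e atTop (𝓝 0)) (hw : Tendsto w atTop (𝓝 w')) :
    Tendsto x atTop (𝓝 xs) := by
  -- Subtracting the noise and adding its limit gives a noise-free recursion with `z - x → 0`; the
  -- drift is still evaluated at `x`.
  set z : ℕ → ℝ := fun n => x n - w n + w' with hz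
  set d : ℕ → ℝ := fun n => h (x n) + e n with hd
  have hzrec : ∀ᶠ n in atTop, z (n + 1) = z n + a n * d n := by
    filter_upwards [hrec] with n hn
    simp only [hz, hd, hn]; ring
  obtain ⟨C, hC⟩ := isCompact_Icc.exists_bound_of_continuousOn hcont
  have hB : ∀ᶠ n in atTop, |d n| ≤ C + 1 := by
    filter_upwards [he.abs.eventually_le_const (show |(0 : ℝ)| < 1 by simp)] with n hn
    exact (abs_add_le _ _).trans (add_le_add (hC _ (hx n)) hn)
  have hzx : ∀ ε > 0, ∀ᶠ n in atTop, |z n - x n| < ε := by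
    intro ε hε
    have : Tendsto (fun n => |z n - x n|) atTop (𝓝 0) := by
      have h1 : Tendsto (fun n => |w' - w n|) atTop (𝓝 |w' - w'|) := (hw.const_sub w').abs
      rw [sub_self, abs_zero] at h1
      refine h1.congr fun n => ?_
      simp only [hz]; congr 1; ring
    exact this.eventually_lt_const hε
  have lower : ∀ ε > 0, ∀ᶠ n in atTop, xs - ε ≤ x n := by
    intro ε hε
    -- Budget: `z ≤ xs - ε / 2` forces `x ≤ xs - ε / 4`, where compactness bounds `h` below by `c`.
    -- The bias takes at most `c / 2`; the barrier and the return from `z` to `x` cost `ε / 4` each.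
    obtain ⟨c, hc, hcl⟩ : ∃ c > 0, ∀ y ∈ Icc (0 : ℝ) 1, y ≤ xs - ε / 4 → c ≤ h y := by
      have hK : IsCompact (Icc (0 : ℝ) 1 ∩ Iic (xs - ε / 4)) := isCompact_Icc.inter_right isClosed_Iic
      rcases (Icc (0 : ℝ) 1 ∩ Iic (xs - ε / 4)).eq_empty_or_nonempty with hem | hne
      · refine ⟨1, one_pos, fun y hy hy' => ?_⟩
        exact absurd (show y ∈ Icc (0 : ℝ) 1 ∩ Iic (xs - ε / 4) from ⟨hy, hy'⟩) (by simp [hem])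
      · obtain ⟨m, hm, hmin⟩ := hK.exists_isMinOn hne (hcont.mono inter_subset_left)
        have hm2 : m ≤ xs - ε / 4 := hm.2
        refine ⟨h m, ?_, fun y hy hy' => hmin ⟨hy, hy'⟩⟩
        have h1 := hsign m hm.1 (by linarith)
        by_contra! h2
        nlinarith
    have h1 : ∀ᶠ n in atTop, z n ≤ xs - ε / 2 → c / 2 ≤ d n := by
      filter_upwards [hzx (ε / 4) (by linarith),
        he.abs.eventually_le_const (show |(0 : ℝ)| < c / 2 by simp [hc])] with n hn hen hzn
      have h2 := hcl (x n) (hx n) (by linarith [(abs_lt.1 hn).1])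
      have h3 := (abs_le.1 hen).1
      simp only [hd]; linarith
    filter_upwards [eventually_ge_of_drift hzrec ha ha0 hasum hB (half_pos hc) h1
      (show 0 < ε / 4 by linarith), hzx (ε / 4) (by linarith)] with n hn1 hn2
    linarith [(abs_lt.1 hn2).2]
  have upper : ∀ ε > 0, ∀ᶠ n in atTop, x n ≤ xs + ε := by
    intro ε hε
    obtain ⟨c, hc, hcl⟩ : ∃ c > 0, ∀ y ∈ Icc (0 : ℝ) 1, xs + ε / 4 ≤ y → h y ≤ -c := by
      have hK : IsCompact (Icc (0 : ℝ) 1 ∩ Ici (xs + ε / 4)) := isCompact_Icc.inter_right isClosed_Ici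
      rcases (Icc (0 : ℝ) 1 ∩ Ici (xs + ε / 4)).eq_empty_or_nonempty with hem | hne
      · refine ⟨1, one_pos, fun y hy hy' => ?_⟩
        exact absurd (show y ∈ Icc (0 : ℝ) 1 ∩ Ici (xs + ε / 4) from ⟨hy, hy'⟩) (by simp [hem])
      · obtain ⟨m, hm, hmax⟩ := hK.exists_isMaxOn hne (hcont.mono inter_subset_left)
        have hm2 : xs + ε / 4 ≤ m := hm.2
        refine ⟨-h m, ?_, fun y hy hy' => by simpa using hmax ⟨hy, hy'⟩⟩
        have h1 := hsign m hm.1 (by linarith)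
        by_contra! h2
        nlinarith
    have h1 : ∀ᶠ n in atTop, -z n ≤ -(xs + ε / 2) → c / 2 ≤ -d n := by
      filter_upwards [hzx (ε / 4) (by linarith),
        he.abs.eventually_le_const (show |(0 : ℝ)| < c / 2 by simp [hc])] with n hn hen hzn
      have h2 := hcl (x n) (hx n) (by linarith [(abs_lt.1 hn).2])
      have h3 := (abs_le.1 hen).2
      simp only [hd]; linarith
    have hzrec' : ∀ᶠ n in atTop, -z (n + 1) = -z n + a n * -d n := by
      filter_upwards [hzrec] with n hn
      rw [hn]; ring
    filter_upwards [eventually_ge_of_drift (z := fun n => -z n) (d := fun n => -d n) hzrec' ha ha0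
      hasum (by simpa using hB) (half_pos hc) h1
      (show 0 < ε / 4 by linarith), hzx (ε / 4) (by linarith)] with n hn1 hn2
    linarith [(abs_lt.1 hn2).1]
  rw [Metric.tendsto_nhds]
  intro ε hε
  filter_upwards [lower (ε / 2) (by linarith), upper (ε / 2) (by linarith)] with n h1 h2
  rw [Real.dist_eq, abs_lt]
  constructor <;> linarith

/-! ### Second moment of sampling without replacement -/

open Finset in
/-- Distinct entries of a uniformly permuted centred population are negatively correlated. -/
theorem sum_perm_mul_nonpos {α : Type*} [Fintype α] [DecidableEq α] (y : α → ℝ)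
    (hy : ∑ a, y a = 0) {a b : α} (hab : a ≠ b) :
    ∑ σ : Equiv.Perm α, y (σ a) * y (σ b) ≤ 0 := by
  have hzero : ∑ c, ∑ σ : Equiv.Perm α, y (σ a) * y (σ c) = 0 := by
    rw [Finset.sum_comm]
    refine Finset.sum_eq_zero fun σ _ => ?_
    rw [← Finset.mul_sum, Equiv.sum_comp σ y, hy, mul_zero]
  -- Precomposing with the swap of `b` and `c` makes all off-diagonal sums equal; together they
  -- cancel the nonnegative diagonal one.
  have hsym : ∀ c ∈ univ.erase a, ∑ σ : Equiv.Perm α, y (σ a) * y (σ c) =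
      ∑ σ : Equiv.Perm α, y (σ a) * y (σ b) := by
    intro c hc
    have hca : c ≠ a := (Finset.mem_erase.1 hc).1
    rw [← Equiv.sum_comp (Equiv.mulRight (Equiv.swap b c))]
    refine Finset.sum_congr rfl fun σ _ => ?_
    simp [Equiv.swap_apply_of_ne_of_ne hab hca.symm]
  rw [← Finset.add_sum_erase _ _ (mem_univ a), Finset.sum_congr rfl hsym, sum_const,
    nsmul_eq_mul] at hzero
  have hpos : (0 : ℝ) < ((univ.erase a).card : ℝ) := by
    exact_mod_cast Finset.card_pos.2 ⟨b, by simp [hab.symm]⟩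
  have hdiag : 0 ≤ ∑ σ : Equiv.Perm α, y (σ a) * y (σ a) :=
    Finset.sum_nonneg fun σ _ => mul_self_nonneg _
  by_contra! hcon
  nlinarith [mul_pos hpos hcon]

open Finset in
/-- Second moment of a sum over a uniformly drawn sample without replacement from a centred
population bounded by `1`. -/
theorem sum_embedding_sq_le {α : Type*} [Fintype α] [DecidableEq α] {k : ℕ} (y : α → ℝ)
    (hy : ∑ a, y a = 0) (hy1 : ∀ a, |y a| ≤ 1) :
    ∑ u : Fin k ↪ α, (∑ i, y (u i)) ^ 2 ≤ Fintype.card (Fin k ↪ α) * k := by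
  have hfac : (0 : ℝ) < Fintype.card (Equiv.Perm α) := by exact_mod_cast Fintype.card_pos
  -- Permuting the population preserves the sum over embeddings, so one may average over
  -- permutations for each fixed `u`, where only the `k` diagonal terms contribute positively.
  have h1 : ∀ u : Fin k ↪ α, ∑ σ : Equiv.Perm α, (∑ i, y (σ (u i))) ^ 2 ≤
      Fintype.card (Equiv.Perm α) * k := by
    intro u
    have hexp : ∑ σ : Equiv.Perm α, (∑ i, y (σ (u i))) ^ 2 =
        ∑ i, ∑ j, ∑ σ : Equiv.Perm α, y (σ (u i)) * y (σ (u j)) := by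
      simp_rw [sq, Finset.sum_mul_sum]
      rw [Finset.sum_comm]
      exact Finset.sum_congr rfl fun i _ => Finset.sum_comm
    rw [hexp]
    have hrow : ∀ i ∈ (univ : Finset (Fin k)),
        ∑ j, ∑ σ : Equiv.Perm α, y (σ (u i)) * y (σ (u j)) ≤ Fintype.card (Equiv.Perm α) := by
      intro i _
      rw [← Finset.add_sum_erase _ _ (mem_univ i)]
      have h2 : ∑ σ : Equiv.Perm α, y (σ (u i)) * y (σ (u i)) ≤ Fintype.card (Equiv.Perm α) := by
        have : ∀ σ ∈ (univ : Finset (Equiv.Perm α)), y (σ (u i)) * y (σ (u i)) ≤ 1 := by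
          intro σ _
          have := hy1 (σ (u i))
          rw [← abs_mul_abs_self]
          exact mul_le_one₀ this (abs_nonneg _) this
        simpa using Finset.sum_le_card_nsmul _ _ _ this
      have h3 : ∑ j ∈ univ.erase i, ∑ σ : Equiv.Perm α, y (σ (u i)) * y (σ (u j)) ≤ 0 :=
        Finset.sum_nonpos fun j hj => sum_perm_mul_nonpos y hy
          fun h => (Finset.mem_erase.1 hj).1 (u.injective h).symm
      linarith
    have := Finset.sum_le_card_nsmul _ _ _ hrow
    simpa [mul_comm] using this
  have h2 : ∀ σ : Equiv.Perm α, ∑ u : Fin k ↪ α, (∑ i, y (σ (u i))) ^ 2 =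
      ∑ u : Fin k ↪ α, (∑ i, y (u i)) ^ 2 := by
    intro σ
    refine Fintype.sum_equiv (Equiv.embeddingCongr (Equiv.refl _) σ) _ _ fun u => ?_
    simp
  have h3 : (Fintype.card (Equiv.Perm α) : ℝ) * ∑ u : Fin k ↪ α, (∑ i, y (u i)) ^ 2 ≤
      Fintype.card (Equiv.Perm α) * (Fintype.card (Fin k ↪ α) * k) := by
    calc _ = ∑ σ : Equiv.Perm α, ∑ u : Fin k ↪ α, (∑ i, y (σ (u i))) ^ 2 := by
          simp [h2]
      _ = ∑ u : Fin k ↪ α, ∑ σ : Equiv.Perm α, (∑ i, y (σ (u i))) ^ 2 := Finset.sum_comm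
      _ ≤ ∑ _u : Fin k ↪ α, (Fintype.card (Equiv.Perm α) * k : ℝ) :=
          Finset.sum_le_sum fun u _ => h1 u
      _ = _ := by simp; ring
  exact le_of_mul_le_mul_left h3 hfac

end Elephant

/-! ### Convergence of the martingale noise -/

namespace Elephant

/-- Weighted sums of the centred increments of a bounded adapted process converge almost surely
when the squared weights are summable. -/
theorem ae_exists_tendsto_sum_centred {Ω : Type*} {mΩ : MeasurableSpace Ω} {μ : Measure Ω}
    [IsProbabilityMeasure μ] {ℱ : Filtration ℕ mΩ} {Y : ℕ → Ω → ℝ}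
    (hY : ∀ n, Measurable[ℱ n] (Y n)) {a : ℕ → ℝ} (hbd : ∀ n ω, |Y n ω| ≤ 1)
    (ha : Summable fun n => a n ^ 2) :
    ∀ᵐ ω ∂μ, ∃ w', Tendsto
      (fun n => ∑ i ∈ Finset.range n, a i * (Y (i + 1) ω - (μ[Y (i + 1) | ℱ i]) ω)) atTop (𝓝 w') := by
  set D : ℕ → Ω → ℝ := fun i => Y (i + 1) - μ[Y (i + 1) | ℱ i] with hD
  set W : ℕ → Ω → ℝ := fun n ω => ∑ i ∈ Finset.range n, a i * D i ω with hW
  have hYint : ∀ n, Integrable (Y n) μ := fun n =>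
    Integrable.of_bound ((hY n).mono (ℱ.le n) le_rfl).aestronglyMeasurable 1
      (ae_of_all _ fun ω => hbd n ω)
  have hcb : ∀ n, ∀ᵐ ω ∂μ, |(μ[Y (n + 1) | ℱ n]) ω| ≤ 1 := fun n =>
    ae_bdd_abs_condExp_of_ae_bdd_abs (R := (1 : ℝ)) (ae_of_all _ fun ω => hbd (n + 1) ω)
  have hDb : ∀ n, ∀ᵐ ω ∂μ, |D n ω| ≤ 2 := by
    intro n
    filter_upwards [hcb n] with ω h
    have h1 := hbd (n + 1) ω
    simp only [hD, Pi.sub_apply]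
    linarith [abs_sub (Y (n + 1) ω) ((μ[Y (n + 1) | ℱ n]) ω)]
  have hDm : ∀ n, StronglyMeasurable[ℱ (n + 1)] (D n) := fun n =>
    (hY (n + 1)).stronglyMeasurable.sub (stronglyMeasurable_condExp.mono (ℱ.mono n.le_succ))
  have hDae : ∀ n, AEStronglyMeasurable (D n) μ := fun n =>
    ((hDm n).mono (ℱ.le _)).aestronglyMeasurable
  have hDint : ∀ n, Integrable (D n) μ := fun n => (hYint _).sub integrable_condExp
  have hDc : ∀ n, μ[D n | ℱ n] =ᵐ[μ] 0 := by
    intro n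
    refine (condExp_sub (hYint _) integrable_condExp _).trans ?_
    rw [condExp_of_stronglyMeasurable (ℱ.le n) stronglyMeasurable_condExp integrable_condExp,
      sub_self]
  have hWm : ∀ n, StronglyMeasurable[ℱ n] (W n) := by
    intro n
    refine Finset.stronglyMeasurable_fun_sum _ fun i hi => ?_
    exact ((hDm i).mono (ℱ.mono (Finset.mem_range.1 hi))).const_mul (a i)
  have hWae : ∀ n, AEStronglyMeasurable (W n) μ := fun n =>
    ((hWm n).mono (ℱ.le _)).aestronglyMeasurable
  have hWs : ∀ n ω, W (n + 1) ω = W n ω + a n * D n ω := fun n ω => by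
    simp only [hW, Finset.sum_range_succ]
  -- This bound depends on `n` and serves integrability only; uniformity in `n` comes from the
  -- second moments.
  have hWb : ∀ n, ∃ R, ∀ᵐ ω ∂μ, |W n ω| ≤ R := by
    intro n
    induction n with
    | zero => exact ⟨0, ae_of_all _ fun ω => by simp [hW]⟩
    | succ n ih =>
      obtain ⟨R, hR⟩ := ih
      refine ⟨R + |a n| * 2, ?_⟩
      filter_upwards [hR, hDb n] with ω h1 h2
      rw [hWs]
      refine (abs_add_le _ _).trans (add_le_add h1 ?_)
      rw [abs_mul]
      exact mul_le_mul_of_nonneg_left h2 (abs_nonneg _)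
  have hWint : ∀ n, Integrable (W n) μ := fun n => by
    obtain ⟨R, hR⟩ := hWb n
    exact Integrable.of_bound (hWae n) R hR
  have hWsq : ∀ n, Integrable (fun ω => W n ω ^ 2) μ := fun n => by
    obtain ⟨R, hR⟩ := hWb n
    refine Integrable.of_bound ((hWae n).pow 2) (R ^ 2) ?_
    filter_upwards [hR] with ω h
    rw [Real.norm_eq_abs, abs_pow]
    exact pow_le_pow_left₀ (abs_nonneg _) h 2
  have hDsq : ∀ n, Integrable (fun ω => D n ω ^ 2) μ := fun n => by
    refine Integrable.of_bound ((hDae n).pow 2) (2 ^ 2) ?_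
    filter_upwards [hDb n] with ω h
    rw [Real.norm_eq_abs, abs_pow]
    exact pow_le_pow_left₀ (abs_nonneg _) h 2
  have hWD : ∀ n, Integrable (W n * D n) μ := fun n => by
    obtain ⟨R, hR⟩ := hWb n
    exact (hDint n).bdd_mul (hWae n) hR
  have horth : ∀ n, ∫ ω, (W n * D n) ω ∂μ = 0 := by
    intro n
    rw [← integral_condExp (ℱ.le n)]
    have h1 : μ[W n * D n | ℱ n] =ᵐ[μ] 0 := by
      refine (condExp_mul_of_stronglyMeasurable_left (hWm n) (hWD n) (hDint n)).trans ?_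
      filter_upwards [hDc n] with ω h
      simp [h]
    rw [integral_congr_ae h1]
    simp
  have hmart : Martingale W ℱ μ := by
    refine martingale_of_condExp_sub_eq_zero_nat hWm hWint fun n => ?_
    have h1 : W (n + 1) - W n = a n • D n := by
      ext ω; simp [hWs]
    rw [h1]
    refine (condExp_smul (a n) (D n) (ℱ n)).trans ?_
    filter_upwards [hDc n] with ω h
    simp [h]
  have hL2 : ∀ n, ∫ ω, W n ω ^ 2 ∂μ ≤ 4 * ∑ i ∈ Finset.range n, a i ^ 2 := by
    intro n
    induction n with
    | zero => simp [hW]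
    | succ n ih =>
      have hD4 : ∫ ω, D n ω ^ 2 ∂μ ≤ 4 := by
        have : ∫ ω, D n ω ^ 2 ∂μ ≤ ∫ _, (4 : ℝ) ∂μ := by
          refine integral_mono_ae (hDsq n) (integrable_const _) ?_
          filter_upwards [hDb n] with ω h
          have := pow_le_pow_left₀ (abs_nonneg _) h 2
          rw [sq_abs] at this
          linarith
        simpa using this
      have hexp : ∫ ω, W (n + 1) ω ^ 2 ∂μ =
          ∫ ω, W n ω ^ 2 ∂μ + a n ^ 2 * ∫ ω, D n ω ^ 2 ∂μ := by
        have h1 : (fun ω => W (n + 1) ω ^ 2) =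
            fun ω => (W n ω ^ 2 + (2 * a n) * (W n * D n) ω) + a n ^ 2 * D n ω ^ 2 := by
          ext ω; simp only [hWs, Pi.mul_apply]; ring
        have h2 : Integrable (fun ω => 2 * a n * (W n * D n) ω) μ := (hWD n).const_mul _
        have h3 : Integrable (fun ω => W n ω ^ 2 + 2 * a n * (W n * D n) ω) μ := (hWsq n).add h2
        rw [h1, integral_add h3 ((hDsq n).const_mul _), integral_add (hWsq n) h2,
          integral_const_mul, integral_const_mul, horth, mul_zero, add_zero]
      rw [hexp, Finset.sum_range_succ]
      have := mul_le_mul_of_nonneg_left hD4 (sq_nonneg (a n))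
      linarith
  -- The `L¹` bound for martingale convergence follows from the `L²` bound by `|W| ≤ 1 + W²`.
  have hbound : ∀ n, eLpNorm (W n) 1 μ ≤ ((1 + 4 * ∑' i, a i ^ 2).toNNReal : ENNReal) := by
    intro n
    rw [eLpNorm_one_eq_lintegral_enorm, ← ofReal_integral_norm_eq_lintegral_enorm (hWint n)]
    refine ENNReal.ofReal_le_ofReal ?_
    have h1 : ∫ ω, ‖W n ω‖ ∂μ ≤ ∫ ω, (1 + W n ω ^ 2) ∂μ := by
      refine integral_mono (hWint n).norm ((integrable_const _).add (hWsq n)) fun ω => ?_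
      simp only [Real.norm_eq_abs]
      nlinarith [sq_abs (W n ω), sq_nonneg (|W n ω| - 1)]
    rw [integral_add (integrable_const _) (hWsq n)] at h1
    have h2 := ha.sum_le_tsum (Finset.range n) fun i _ => sq_nonneg (a i)
    have h3 := hL2 n
    simp only [integral_const, probReal_univ, smul_eq_mul, mul_one] at h1
    linarith
  filter_upwards [hmart.submartingale.ae_tendsto_limitProcess hbound] with ω h
  exact ⟨_, h⟩

/-! ### Conditional law of the sample -/

section Sample

variable {Ω : Type*} {mΩ : MeasurableSpace Ω} {μ : Measure Ω}
  {p q : ℝ} {f : ℝ → ℝ} {k : ℕ → ℕ} {ℱ : Filtration ℕ mΩ} {X : ℕ → Ω → ℝ}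
  {U : (n : ℕ) → Ω → Fin (k n) → ℕ}

/-- The tuple of time-stamps underlying an embedding into `{1, …, n}`. -/
def tuple {k n : ℕ} (u : Fin k ↪ ↥(Finset.Icc 1 n)) (i : Fin k) : ℕ := (u i : ℕ)

theorem tuple_injective {k n : ℕ} :
    Function.Injective (tuple : (Fin k ↪ ↥(Finset.Icc 1 n)) → Fin k → ℕ) := by
  intro u v h
  ext i
  exact congrFun h i

theorem card_tuples (k n : ℕ) :
    Fintype.card (Fin k ↪ ↥(Finset.Icc 1 n)) = n.choose k * k.factorial := by
  rw [Fintype.card_embedding_eq, Fintype.card_coe, Nat.card_Icc, Fintype.card_fin,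
    Nat.descFactorial_eq_factorial_mul_choose, mul_comm, Nat.add_sub_cancel]

theorem card_tuples_pos {k n : ℕ} (h : k ≤ n) :
    (0 : ℝ) < Fintype.card (Fin k ↪ ↥(Finset.Icc 1 n)) := by
  rw [card_tuples]
  exact_mod_cast Nat.mul_pos (Nat.choose_pos h) k.factorial_pos

theorem IsWalkWithoutReplacement.condProb_sample (hX : IsWalkWithoutReplacement μ p q f k ℱ X U)
    {n : ℕ} (hn : 1 ≤ n) (u : Fin (k n) ↪ ↥(Finset.Icc 1 n)) :
    μ⟦{ω | U n ω = tuple u} | ℱ n⟧ =ᵐ[μ]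
      fun _ => (Fintype.card (Fin (k n) ↪ ↥(Finset.Icc 1 n)) : ℝ)⁻¹ := by
  rw [card_tuples]
  exact hX.sample_law n hn (tuple u) (fun i j h => u.injective (Subtype.ext h)) fun i => (u i).2

theorem IsWalkWithoutReplacement.measurableSet_sample
    (hX : IsWalkWithoutReplacement μ p q f k ℱ X U) {n : ℕ} (hn : 1 ≤ n) (u : Fin (k n) → ℕ) :
    MeasurableSet {ω | U n ω = u} :=
  hX.measurable_sample n hn (measurableSet_singleton u)

/-- `sample_law` prescribes only the admissible tuples. Integrated, it gives each of these disjoint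
events probability one over their number, so they exhaust the total mass. -/
theorem IsWalkWithoutReplacement.ae_sample_mem [IsProbabilityMeasure μ]
    (hX : IsWalkWithoutReplacement μ p q f k ℱ X U)
    {n : ℕ} (hn : 1 ≤ n) (hk : k n ≤ n) :
    ∀ᵐ ω ∂μ, ∃ u : Fin (k n) ↪ ↥(Finset.Icc 1 n), U n ω = tuple u := by
  have hpr : ∀ u : Fin (k n) ↪ ↥(Finset.Icc 1 n), μ.real {ω | U n ω = tuple u} =
      (Fintype.card (Fin (k n) ↪ ↥(Finset.Icc 1 n)) : ℝ)⁻¹ := by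
    intro u
    have h1 := integral_condExp (μ := μ) (ℱ.le n)
      (f := ({ω | U n ω = tuple u}).indicator fun _ => (1 : ℝ))
    rw [integral_congr_ae (hX.condProb_sample hn u),
      integral_indicator_const _ (hX.measurableSet_sample hn _)] at h1
    simpa using h1.symm
  have hunion : μ.real (⋃ u ∈ (Finset.univ : Finset (Fin (k n) ↪ ↥(Finset.Icc 1 n))),
      {ω | U n ω = tuple u}) = 1 := by
    rw [measureReal_biUnion_finset]
    · rw [Finset.sum_congr rfl fun u _ => hpr u, Finset.sum_const, Finset.card_univ, nsmul_eq_mul,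
        mul_inv_cancel₀ (card_tuples_pos hk).ne']
    · intro u _ v _ huv
      refine Set.disjoint_left.2 fun ω h1 h2 => huv (tuple_injective ?_)
      exact (show U n ω = tuple u from h1).symm.trans h2
    · exact fun u _ => hX.measurableSet_sample hn _
  have hm : MeasurableSet (⋃ u ∈ (Finset.univ : Finset (Fin (k n) ↪ ↥(Finset.Icc 1 n))),
      {ω | U n ω = tuple u}) :=
    Finset.measurableSet_biUnion _ fun u _ => hX.measurableSet_sample hn _
  have h1 : μ (⋃ u ∈ (Finset.univ : Finset (Fin (k n) ↪ ↥(Finset.Icc 1 n))),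
      {ω | U n ω = tuple u}) = 1 := by
    rw [← ENNReal.ofReal_one, ← hunion, ofReal_measureReal (measure_ne_top _ _)]
  filter_upwards [(mem_ae_iff_prob_eq_one hm).2 h1] with ω hω
  simpa using hω

/-- The conditional expectation given the past of a function of the past and the sample is the
average of that function over all samples. -/
theorem IsWalkWithoutReplacement.condExp_sample [IsProbabilityMeasure μ]
    (hX : IsWalkWithoutReplacement μ p q f k ℱ X U)
    {n : ℕ} (hn : 1 ≤ n) (hk : k n ≤ n) {φ : (Fin (k n) → ℕ) → Ω → ℝ} {c : ℝ}
    (hφ : ∀ u : Fin (k n) ↪ ↥(Finset.Icc 1 n), Measurable[ℱ n] (φ (tuple u)))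
    (hc : ∀ (u : Fin (k n) ↪ ↥(Finset.Icc 1 n)) ω, |φ (tuple u) ω| ≤ c) :
    μ[fun ω => φ (U n ω) ω | ℱ n] =ᵐ[μ]
      fun ω => (Fintype.card (Fin (k n) ↪ ↥(Finset.Icc 1 n)) : ℝ)⁻¹ *
        ∑ u : Fin (k n) ↪ ↥(Finset.Icc 1 n), φ (tuple u) ω := by
  classical
  set I : (Fin (k n) ↪ ↥(Finset.Icc 1 n)) → Ω → ℝ :=
    fun u => ({ω | U n ω = tuple u}).indicator fun _ => (1 : ℝ) with hI
  have hIint : ∀ u, Integrable (I u) μ := fun u =>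
    (integrable_const (1 : ℝ)).indicator (hX.measurableSet_sample hn _)
  have hint : ∀ u, Integrable (φ (tuple u) * I u) μ := fun u =>
    (hIint u).bdd_mul ((hφ u).mono (ℱ.le n) le_rfl).aestronglyMeasurable
      (ae_of_all _ fun ω => hc u ω)
  -- Fixing the sample value leaves an `ℱ n`-measurable factor, which can be pulled out of the
  -- conditional expectation.
  have hdecomp : (fun ω => φ (U n ω) ω) =ᵐ[μ] ∑ u, φ (tuple u) * I u := by
    filter_upwards [hX.ae_sample_mem hn hk] with ω ⟨u, hu⟩
    rw [Finset.sum_apply, Finset.sum_eq_single u]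
    · simp [hI, hu]
    · intro v _ hv
      have : U n ω ≠ tuple v := fun h => hv (tuple_injective (h.symm.trans hu))
      simp [hI, this]
    · simp
  refine (condExp_congr_ae hdecomp).trans ((condExp_finsetSum (fun u _ => hint u) _).trans ?_)
  have hall : ∀ᵐ ω ∂μ, ∀ u, (μ[φ (tuple u) * I u | ℱ n]) ω =
      φ (tuple u) ω * (Fintype.card (Fin (k n) ↪ ↥(Finset.Icc 1 n)) : ℝ)⁻¹ := by
    refine ae_all_iff.2 fun u => ?_
    filter_upwards [condExp_mul_of_stronglyMeasurable_left (hφ u).stronglyMeasurable (hint u)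
      (hIint u), hX.condProb_sample hn u] with ω h1 h2
    rw [h1, Pi.mul_apply, h2]
  filter_upwards [hall] with ω h
  rw [Finset.sum_apply, Finset.sum_congr rfl fun u _ => h u, ← Finset.sum_mul, mul_comm]

end Sample

/-! ### Sampled proportion against population proportion -/

/-- The number of `+1`-valued steps among the first `n` steps of a trajectory. -/
noncomputable def plusTotal (x : ℕ → ℝ) (n : ℕ) : ℕ :=
  ((Finset.Icc 1 n).filter fun i => x i = 1).card

theorem plusTotal_le (x : ℕ → ℝ) (n : ℕ) : plusTotal x n ≤ n :=
  (Finset.card_filter_le _ _).trans (by simp)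

theorem plusCount_le {k : ℕ} (x : ℕ → ℝ) (u : Fin k → ℕ) : plusCount x u ≤ k :=
  (Finset.card_filter_le _ _).trans (by simp)

theorem div_mem_unitInterval {a b : ℕ} (h : a ≤ b) : (a : ℝ) / (b : ℝ) ∈ Icc (0 : ℝ) 1 :=
  ⟨by positivity, div_le_one_of_le₀ (by exact_mod_cast h) (by positivity)⟩

/-- The mean square deviation of the sampled proportion from the population proportion. -/
theorem sum_sq_proportion_sub_le (x : ℕ → ℝ) {k n : ℕ} (hk : 1 ≤ k) (hn : 1 ≤ n) :
    ∑ u : Fin k ↪ ↥(Finset.Icc 1 n),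
        ((plusCount x (tuple u) : ℝ) / k - (plusTotal x n : ℝ) / n) ^ 2 ≤
      Fintype.card (Fin k ↪ ↥(Finset.Icc 1 n)) / k := by
  classical
  set θ : ℝ := (plusTotal x n : ℝ) / n with hθ
  have hθmem : θ ∈ Icc (0 : ℝ) 1 := div_mem_unitInterval (plusTotal_le x n)
  set y : ↥(Finset.Icc 1 n) → ℝ := fun a => (if x a = 1 then 1 else 0) - θ with hy
  have hn0 : (n : ℝ) ≠ 0 := by positivity
  have hk0 : (0 : ℝ) < k := by exact_mod_cast hk
  have hsum : ∑ a, y a = 0 := by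
    simp only [hy, Finset.sum_sub_distrib]
    rw [Finset.sum_coe_sort (Finset.Icc 1 n) (fun a => if x a = 1 then (1 : ℝ) else 0),
      Finset.sum_boole]
    simp only [Finset.sum_const, Finset.card_univ, Fintype.card_coe, Nat.card_Icc,
      Nat.add_sub_cancel, nsmul_eq_mul, hθ, plusTotal]
    field_simp
    simp
  have hy1 : ∀ a, |y a| ≤ 1 := by
    intro a
    rw [abs_le]
    simp only [hy]
    split_ifs <;> constructor <;> linarith [hθmem.1, hθmem.2]
  have h := sum_embedding_sq_le (k := k) y hsum hy1
  have hterm : ∀ u : Fin k ↪ ↥(Finset.Icc 1 n),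
      (plusCount x (tuple u) : ℝ) / k - θ = (∑ i, y (u i)) / k := by
    intro u
    have : ∑ i, y (u i) = plusCount x (tuple u) - k * θ := by
      simp only [hy, Finset.sum_sub_distrib, Finset.sum_boole]
      simp only [plusCount, tuple, Finset.sum_const, Finset.card_univ, Fintype.card_fin,
        nsmul_eq_mul]
      congr!
    rw [this]
    field_simp
  simp_rw [hterm, div_pow]
  rw [← Finset.sum_div, div_le_div_iff₀ (by positivity) hk0]
  nlinarith [mul_le_mul_of_nonneg_right h hk0.le]

/-- The average over all samples of a continuous function of the sampled proportion is close to
its value at the population proportion, uniformly over trajectories, for large sample sizes. -/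
theorem abs_average_sub_le {φ : ℝ → ℝ} (hφc : ContinuousOn φ (Icc 0 1))
    (hφ : ∀ x ∈ Icc (0 : ℝ) 1, φ x ∈ Icc (0 : ℝ) 1) {ε : ℝ} (hε : 0 < ε) :
    ∃ K : ℕ, ∀ k n : ℕ, K ≤ k → 1 ≤ k → k ≤ n → ∀ x : ℕ → ℝ,
      |(Fintype.card (Fin k ↪ ↥(Finset.Icc 1 n)) : ℝ)⁻¹ *
          ∑ u : Fin k ↪ ↥(Finset.Icc 1 n), φ ((plusCount x (tuple u) : ℝ) / k) -
        φ ((plusTotal x n : ℝ) / n)| ≤ ε := by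
  obtain ⟨δ, hδ, hδφ⟩ := Metric.uniformContinuousOn_iff.1
    (isCompact_Icc.uniformContinuousOn_of_continuous hφc) (ε / 2) (half_pos hε)
  -- Chosen so that the Chebyshev term `1 / (k * δ ^ 2)` is at most `ε / 2`.
  obtain ⟨K, hK⟩ := exists_nat_gt (2 / (ε * δ ^ 2))
  refine ⟨K, fun k n hKk hk hkn x => ?_⟩
  set θ : ℝ := (plusTotal x n : ℝ) / n
  have hθ : θ ∈ Icc (0 : ℝ) 1 := div_mem_unitInterval (plusTotal_le x n)
  have hN := card_tuples_pos hkn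
  set N : ℝ := (Fintype.card (Fin k ↪ ↥(Finset.Icc 1 n)) : ℝ) with hNdef
  have hk0 : (0 : ℝ) < k := by exact_mod_cast hk
  -- Within `δ` uniform continuity gives `ε / 2`; otherwise the trivial bound `1` is dominated by
  -- the squared deviation over `δ ^ 2`.
  have hpt : ∀ u : Fin k ↪ ↥(Finset.Icc 1 n), |φ ((plusCount x (tuple u) : ℝ) / k) - φ θ| ≤
      ε / 2 + ((plusCount x (tuple u) : ℝ) / k - θ) ^ 2 / δ ^ 2 := by
    intro u
    have hu := div_mem_unitInterval (plusCount_le x (tuple u))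
    set t : ℝ := (plusCount x (tuple u) : ℝ) / k
    rcases lt_or_ge (dist t θ) δ with h | h
    · have h1 := (hδφ t hu θ hθ h).le
      rw [Real.dist_eq] at h1
      have : 0 ≤ (t - θ) ^ 2 / δ ^ 2 := by positivity
      linarith
    · rw [Real.dist_eq] at h
      have h1 : 1 ≤ (t - θ) ^ 2 / δ ^ 2 := by
        rw [one_le_div (by positivity), ← sq_abs (t - θ)]
        exact pow_le_pow_left₀ hδ.le h 2
      have h2 : |φ t - φ θ| ≤ 1 := by
        rw [abs_le]
        constructor <;> linarith [(hφ t hu).1, (hφ t hu).2, (hφ θ hθ).1, (hφ θ hθ).2]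
      linarith
  have hsum : |∑ u : Fin k ↪ ↥(Finset.Icc 1 n), (φ ((plusCount x (tuple u) : ℝ) / k) - φ θ)| ≤
      N * ε := by
    refine (Finset.abs_sum_le_sum_abs _ _).trans ((Finset.sum_le_sum fun u _ => hpt u).trans ?_)
    rw [Finset.sum_add_distrib, Finset.sum_const, Finset.card_univ, nsmul_eq_mul,
      ← hNdef]
    have h1 : (∑ u : Fin k ↪ ↥(Finset.Icc 1 n), ((plusCount x (tuple u) : ℝ) / k - θ) ^ 2) / δ ^ 2
        ≤ N / k / δ ^ 2 :=
      div_le_div_of_nonneg_right (sum_sq_proportion_sub_le x hk (hk.trans hkn)) (by positivity)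
    have h2 : N / k / δ ^ 2 ≤ N * (ε / 2) := by
      have h3 : 2 / (ε * δ ^ 2) < k := hK.trans_le (by exact_mod_cast hKk)
      rw [div_lt_iff₀ (by positivity)] at h3
      rw [div_div, div_le_iff₀ (by positivity)]
      nlinarith
    rw [← Finset.sum_div]
    linarith
  have heq : N⁻¹ * ∑ u : Fin k ↪ ↥(Finset.Icc 1 n), φ ((plusCount x (tuple u) : ℝ) / k) - φ θ =
      N⁻¹ * ∑ u : Fin k ↪ ↥(Finset.Icc 1 n), (φ ((plusCount x (tuple u) : ℝ) / k) - φ θ) := by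
    rw [Finset.sum_sub_distrib, Finset.sum_const, Finset.card_univ, nsmul_eq_mul, ← hNdef]
    field_simp
  rw [heq, abs_mul, abs_of_pos (inv_pos.2 hN), inv_mul_le_iff₀ hN]
  exact hsum

end Elephant

/-! ### The walk as a stochastic approximation -/

namespace Elephant

section Walk

variable {Ω : Type*} {mΩ : MeasurableSpace Ω} {μ : Measure Ω}
  {p q : ℝ} {f : ℝ → ℝ} {k : ℕ → ℕ} {ℱ : Filtration ℕ mΩ} {X : ℕ → Ω → ℝ}
  {U : (n : ℕ) → Ω → Fin (k n) → ℕ}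

/-- `g` is a convex combination of `p` and `1 - p`. The open interval matters: it makes the drift
positive at `0` and negative at `1`, and keeps fixed points interior. -/
theorem g_mem_unitInterval (hp0 : 0 < p) (hp1 : p < 1)
    (hf : ∀ x ∈ Icc (0 : ℝ) 1, f x ∈ Icc (0 : ℝ) 1) {x : ℝ} (hx : x ∈ Icc (0 : ℝ) 1) :
    g p f x ∈ Ioo (0 : ℝ) 1 := by
  obtain ⟨h0, h1⟩ := hf x hx
  simp only [g]
  rcases h0.eq_or_lt with h | h
  · rw [← h]; constructor <;> linarith
  · have h2 : 0 < p * f x := mul_pos hp0 h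
    have h3 : 0 < (1 - p) * f x := mul_pos (sub_pos.2 hp1) h
    have h4 : 0 ≤ p * (1 - f x) := mul_nonneg hp0.le (sub_nonneg.2 h1)
    have h5 : 0 ≤ (1 - p) * (1 - f x) := mul_nonneg (sub_pos.2 hp1).le (sub_nonneg.2 h1)
    constructor <;> linarith

theorem IsWalkWithoutReplacement.measurableSet_step (hX : IsWalkWithoutReplacement μ p q f k ℱ X U)
    (n : ℕ) (c : ℝ) : MeasurableSet[ℱ n] {ω | X n ω = c} :=
  hX.adapted n (measurableSet_singleton c)

theorem IsWalkWithoutReplacement.sup_comap_le (hX : IsWalkWithoutReplacement μ p q f k ℱ X U)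
    {n : ℕ} (hn : 1 ≤ n) : ℱ n ⊔ MeasurableSpace.comap (U n) inferInstance ≤ mΩ :=
  sup_le (ℱ.le n) (hX.measurable_sample n hn).comap_le

/-- The two conditional probabilities add up to `1`, leaving no mass for other values. -/
theorem IsWalkWithoutReplacement.ae_step (hX : IsWalkWithoutReplacement μ p q f k ℱ X U)
    [IsProbabilityMeasure μ] (hq : q ∈ Icc (0 : ℝ) 1) {n : ℕ} (hn : 1 ≤ n) :
    ∀ᵐ ω ∂μ, X n ω = 1 ∨ X n ω = -1 := by
  have hms : ∀ c, MeasurableSet {ω | X n ω = c} := fun c => ℱ.le n _ (hX.measurableSet_step n c)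
  have hsum : μ.real {ω | X n ω = 1} + μ.real {ω | X n ω = -1} = 1 := by
    obtain rfl | ⟨m, hm, rfl⟩ : n = 1 ∨ ∃ m, 1 ≤ m ∧ n = m + 1 := by
      rcases hn.eq_or_lt with h | h
      · exact Or.inl h.symm
      · exact Or.inr ⟨n - 1, by omega, by omega⟩
    · rw [measureReal_def, measureReal_def, hX.first_plus, hX.first_minus,
        ENNReal.toReal_ofReal hq.1, ENNReal.toReal_ofReal (by linarith [hq.2])]
      ring
    · have hint : ∀ c, μ.real {ω | X (m + 1) ω = c} = ∫ ω, (μ⟦{ω | X (m + 1) ω = c} |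
          ℱ m ⊔ MeasurableSpace.comap (U m) inferInstance⟧) ω ∂μ := by
        intro c
        rw [integral_condExp (hX.sup_comap_le hm), integral_indicator_const _ (hms c)]
        simp
      rw [hint, hint, ← integral_add integrable_condExp integrable_condExp]
      have : ∀ᵐ ω ∂μ, (μ⟦{ω | X (m + 1) ω = 1} |
            ℱ m ⊔ MeasurableSpace.comap (U m) inferInstance⟧) ω +
          (μ⟦{ω | X (m + 1) ω = -1} |
            ℱ m ⊔ MeasurableSpace.comap (U m) inferInstance⟧) ω = 1 := by
        filter_upwards [hX.step_plus m hm, hX.step_minus m hm] with ω h1 h2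
        rw [h1, h2]; ring
      rw [integral_congr_ae this]
      simp
  have hdisj : Disjoint {ω | X n ω = 1} {ω | X n ω = -1} :=
    Set.disjoint_left.2 fun ω (h1 : X n ω = 1) (h2 : X n ω = -1) => by norm_num [h1] at h2
  rw [← measureReal_union hdisj (hms _)] at hsum
  have h1 : μ ({ω | X n ω = 1} ∪ {ω | X n ω = -1}) = 1 := by
    rw [← ofReal_measureReal (measure_ne_top _ _), hsum, ENNReal.ofReal_one]
  exact (mem_ae_iff_prob_eq_one ((hms _).union (hms _))).2 h1

theorem IsWalkWithoutReplacement.measurable_plusCount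
    (hX : IsWalkWithoutReplacement μ p q f k ℱ X U) {n : ℕ}
    (u : Fin (k n) ↪ ↥(Finset.Icc 1 n)) :
    Measurable[ℱ n] fun ω => plusCount (fun j => X j ω) (tuple u) := by
  simp only [plusCount, Finset.card_filter]
  refine Finset.measurable_fun_sum _ fun i _ => ?_
  refine Measurable.ite ?_ measurable_const measurable_const
  exact ℱ.mono (Finset.mem_Icc.1 (u i).2).2 _ (hX.measurableSet_step (tuple u i) 1)

/-- The conditional probability of a `+1`-step given the past is an average over samples. -/
theorem IsWalkWithoutReplacement.condExp_step (hX : IsWalkWithoutReplacement μ p q f k ℱ X U)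
    [IsProbabilityMeasure μ] (hp0 : 0 < p) (hp1 : p < 1)
    (hf : ∀ x ∈ Icc (0 : ℝ) 1, f x ∈ Icc (0 : ℝ) 1) {n : ℕ} (hn : 1 ≤ n) (hk : k n ≤ n) :
    μ⟦{ω | X (n + 1) ω = 1} | ℱ n⟧ =ᵐ[μ]
      fun ω => (Fintype.card (Fin (k n) ↪ ↥(Finset.Icc 1 n)) : ℝ)⁻¹ *
        ∑ u : Fin (k n) ↪ ↥(Finset.Icc 1 n),
          g p f ((plusCount (fun j => X j ω) (tuple u) : ℝ) / (k n : ℝ)) := by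
  -- Tower property: condition on the past and the sample, then average over the sample.
  have h1 := condExp_condExp_of_le (μ := μ)
    (f := ({ω | X (n + 1) ω = 1}).indicator fun _ => (1 : ℝ))
    (le_sup_left : ℱ n ≤ ℱ n ⊔ MeasurableSpace.comap (U n) inferInstance) (hX.sup_comap_le hn)
  refine h1.symm.trans ((condExp_congr_ae (hX.step_plus n hn)).trans ?_)
  refine hX.condExp_sample hn hk (c := 1)
    (φ := fun u ω => g p f ((plusCount (fun j => X j ω) u : ℝ) / (k n : ℝ))) (fun u => ?_) ?_
  · exact (measurable_from_nat (f := fun m : ℕ => g p f ((m : ℝ) / (k n : ℝ)))).comp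
      (hX.measurable_plusCount u)
  · intro u ω
    have := g_mem_unitInterval hp0 hp1 hf
      (div_mem_unitInterval (plusCount_le (fun j => X j ω) (tuple u)))
    rw [abs_le]
    exact ⟨by linarith [this.1], this.2.le⟩

theorem plusTotal_succ (x : ℕ → ℝ) (n : ℕ) :
    (plusTotal x (n + 1) : ℝ) = plusTotal x n + if x (n + 1) = 1 then 1 else 0 := by
  simp only [plusTotal, Finset.card_filter, Nat.cast_sum, Nat.cast_ite, Nat.cast_one, Nat.cast_zero]
  rw [Finset.sum_Icc_succ_top (by omega)]

theorem position_eq {n : ℕ} {ω : Ω} (h : ∀ i, 1 ≤ i → X i ω = 1 ∨ X i ω = -1) :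
    position X n ω = 2 * plusTotal (fun j => X j ω) n - n := by
  induction n with
  | zero => simp [position, plusTotal]
  | succ n ih =>
    rw [plusTotal_succ]
    simp only [position] at ih ⊢
    rw [Finset.sum_Icc_succ_top (by omega), ih]
    rcases h (n + 1) (by omega) with h1 | h1 <;> rw [h1] <;> push_cast <;> norm_num <;> ring

/-- The walk with a continuous reinforcement function whose sample sizes tend to infinity
converges to the fixed point towards which the drift points. -/
theorem IsWalkWithoutReplacement.convergesTo (hX : IsWalkWithoutReplacement μ p q f k ℱ X U)
    [IsProbabilityMeasure μ] (hp0 : 0 < p) (hp1 : p < 1) (hq : q ∈ Icc (0 : ℝ) 1)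
    (hf : ∀ x ∈ Icc (0 : ℝ) 1, f x ∈ Icc (0 : ℝ) 1)
    (hk_le : ∀ n, 1 ≤ n → k n ≤ n) (hk_top : Tendsto k atTop atTop)
    (hg : ContinuousOn (g p f) (Icc 0 1)) {xs : ℝ}
    (hsign : ∀ x ∈ Icc (0 : ℝ) 1, x ≠ xs → (g p f x - x) * (x - xs) < 0) :
    ConvergesTo μ X xs := by
  set Y : ℕ → Ω → ℝ := fun n => ({ω | X n ω = 1}).indicator fun _ => (1 : ℝ) with hY
  have hYm : ∀ n, Measurable[ℱ n] (Y n) := fun n =>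
    measurable_const.indicator (hX.measurableSet_step n 1)
  have hYb : ∀ n ω, |Y n ω| ≤ 1 := by
    intro n ω
    simp only [hY, Set.indicator_apply]
    split_ifs <;> simp
  set a : ℕ → ℝ := fun n => 1 / ((n : ℝ) + 1) with ha
  have ha0 : Tendsto a atTop (𝓝 0) := tendsto_one_div_add_atTop_nhds_zero_nat
  have hasum : Tendsto (fun n => ∑ i ∈ Finset.range n, a i) atTop atTop :=
    Real.tendsto_sum_range_one_div_nat_succ_atTop
  have hasq : Summable fun n => a n ^ 2 := by
    have h1 := (summable_nat_add_iff 1).2 (Real.summable_one_div_nat_pow.2 one_lt_two)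
    refine h1.congr fun n => ?_
    simp [ha]
  -- The tolerances `1 / (j + 1)` are countably many, so the exceptional null sets can be united.
  have hbias : ∀ j : ℕ, ∀ᶠ n in atTop, ∀ᵐ ω ∂μ,
      |(μ[Y (n + 1) | ℱ n]) ω - g p f ((plusTotal (fun i => X i ω) n : ℝ) / n)| ≤
        1 / ((j : ℝ) + 1) := by
    intro j
    obtain ⟨K, hK⟩ := abs_average_sub_le hg
      (fun x hx => Ioo_subset_Icc_self (g_mem_unitInterval hp0 hp1 hf hx))
      (ε := 1 / ((j : ℝ) + 1)) (by positivity)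
    filter_upwards [hk_top.eventually_ge_atTop K, hk_top.eventually_ge_atTop 1,
      eventually_ge_atTop 1] with n h1 h2 h3
    filter_upwards [hX.condExp_step hp0 hp1 hf h3 (hk_le n h3)] with ω hω
    rw [hω]
    exact hK (k n) n h1 h2 (hk_le n h3) fun i => X i ω
  have hbias' : ∀ᵐ ω ∂μ, Tendsto (fun n : ℕ => (μ[Y (n + 1) | ℱ n]) ω -
      g p f ((plusTotal (fun i => X i ω) n : ℝ) / n)) atTop (𝓝 0) := by
    have h1 : ∀ᵐ ω ∂μ, ∀ j : ℕ, ∀ᶠ n in atTop,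
        |(μ[Y (n + 1) | ℱ n]) ω - g p f ((plusTotal (fun i => X i ω) n : ℝ) / n)| ≤
          1 / ((j : ℝ) + 1) := by
      refine ae_all_iff.2 fun j => ?_
      obtain ⟨N, hN⟩ := eventually_atTop.1 (hbias j)
      have : ∀ᵐ ω ∂μ, ∀ n, N ≤ n →
          |(μ[Y (n + 1) | ℱ n]) ω - g p f ((plusTotal (fun i => X i ω) n : ℝ) / n)| ≤
            1 / ((j : ℝ) + 1) :=
        ae_all_iff.2 fun n => by
          by_cases h : N ≤ n
          · filter_upwards [hN n h] with ω hω _ using hω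
          · exact ae_of_all _ fun ω h' => absurd h' h
      filter_upwards [this] with ω hω
      exact eventually_atTop.2 ⟨N, hω⟩
    filter_upwards [h1] with ω hω
    rw [Metric.tendsto_nhds]
    intro ε hε
    obtain ⟨j, hj⟩ := exists_nat_one_div_lt hε
    filter_upwards [hω j] with n hn
    rw [Real.dist_eq, sub_zero]
    exact hn.trans_lt hj
  have hsteps : ∀ᵐ ω ∂μ, ∀ n, 1 ≤ n → X n ω = 1 ∨ X n ω = -1 :=
    ae_all_iff.2 fun n => by
      by_cases h : 1 ≤ n
      · filter_upwards [hX.ae_step hq h] with ω hω _ using hω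
      · exact ae_of_all _ fun ω h' => absurd h' h
  filter_upwards [hbias', hsteps, ae_exists_tendsto_sum_centred (μ := μ) hYm hYb hasq]
    with ω he hs ⟨w', hw⟩
  -- The `g`-terms and the conditional expectations cancel, leaving the update of an empirical mean.
  have hrec : ∀ᶠ n : ℕ in atTop, (plusTotal (fun i => X i ω) (n + 1) : ℝ) / ((n + 1 : ℕ) : ℝ) =
      (plusTotal (fun i => X i ω) n : ℝ) / n +
        a n * ((g p f ((plusTotal (fun i => X i ω) n : ℝ) / n) -
          (plusTotal (fun i => X i ω) n : ℝ) / n) + ((μ[Y (n + 1) | ℱ n]) ω -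
            g p f ((plusTotal (fun i => X i ω) n : ℝ) / n))) +
        ((∑ i ∈ Finset.range (n + 1), a i * (Y (i + 1) ω - (μ[Y (i + 1) | ℱ i]) ω)) -
          ∑ i ∈ Finset.range n, a i * (Y (i + 1) ω - (μ[Y (i + 1) | ℱ i]) ω)) := by
    filter_upwards [eventually_ge_atTop 1] with n hn
    have hYn : (if X (n + 1) ω = 1 then (1 : ℝ) else 0) = Y (n + 1) ω := by
      simp [hY, Set.indicator_apply]
    have hn0 : (n : ℝ) ≠ 0 := by positivity
    have hn1 : (n : ℝ) + 1 ≠ 0 := by positivity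
    rw [Finset.sum_range_succ, plusTotal_succ, hYn]
    simp only [ha]
    push_cast
    field_simp
    ring
  have hlim := tendsto_of_perturbed_recursion
    (x := fun n => (plusTotal (fun i => X i ω) n : ℝ) / n) (h := fun y => g p f y - y)
    (fun n => div_mem_unitInterval (plusTotal_le _ n)) (hg.sub continuousOn_id) hsign hrec
    (fun n => by positivity) ha0 hasum he hw
  refine ((hlim.const_mul 2).sub_const 1).congr' ?_
  filter_upwards [eventually_ge_atTop 1] with n hn
  have hn0 : (n : ℝ) ≠ 0 := by positivity
  rw [position_eq hs]
  field_simp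

end Walk

/-! ### Fixed points of `g` and the sign of the drift -/

theorem CondF2.continuousOn {f : ℝ → ℝ} {k : ℕ → ℕ} (h : CondF2 f k) :
    ContinuousOn f (Icc 0 1) := by
  obtain ⟨α, L, hα, -, hL, -⟩ := h
  intro x hx
  rw [ContinuousWithinAt, tendsto_iff_dist_tendsto_zero]
  have h1 : Tendsto (fun y => L * |y - x| ^ α) (𝓝[Icc 0 1] x) (𝓝 0) := by
    have h2 : Continuous fun y : ℝ => L * |y - x| ^ α :=
      continuous_const.mul ((continuous_id.sub continuous_const).abs.rpow_const
        fun _ => Or.inr hα.le)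
    have h3 := (h2.tendsto x).mono_left (nhdsWithin_le_nhds (s := Icc 0 1))
    simpa [Real.zero_rpow hα.ne'] using h3
  refine squeeze_zero' (Eventually.of_forall fun _ => dist_nonneg) ?_ h1
  filter_upwards [self_mem_nhdsWithin] with y hy
  rw [Real.dist_eq]
  exact hL y hy x hx

theorem g_eq (p : ℝ) (f : ℝ → ℝ) (x : ℝ) : g p f x = (2 * p - 1) * f x + (1 - p) := by
  simp only [g]; ring

theorem continuousOn_g {p : ℝ} {f : ℝ → ℝ} (hf : ContinuousOn f (Icc 0 1)) :
    ContinuousOn (g p f) (Icc 0 1) := by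
  refine ((continuousOn_const.mul hf).add continuousOn_const).congr fun x _ => g_eq p f x

/-- A drift of the wrong sign at `x < xs` would, since `φ 0 ≥ 0`, produce a fixed point in `[0, x]`,
contradicting uniqueness; the case `x > xs` is symmetric, using `φ 1 ≤ 1`. -/
theorem IsUniqueFixedPoint.drift_neg {φ : ℝ → ℝ} {xs : ℝ} (h : IsUniqueFixedPoint φ xs)
    (hc : ContinuousOn φ (Icc 0 1)) (hφ : ∀ x ∈ Icc (0 : ℝ) 1, φ x ∈ Icc (0 : ℝ) 1)
    {x : ℝ} (hx : x ∈ Icc (0 : ℝ) 1) (hne : x ≠ xs) : (φ x - x) * (x - xs) < 0 := by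
  rcases hne.lt_or_gt with hlt | hgt
  · refine mul_neg_of_pos_of_neg ?_ (sub_neg.2 hlt)
    by_contra! hcon
    obtain ⟨c, hcm, hcf⟩ := exists_mem_Icc_isFixedPt
      (hc.mono (Icc_subset_Icc_right hx.2)) hx.1 (hφ 0 ⟨le_rfl, zero_le_one⟩).1 (by linarith)
    exact absurd (h.2.2 c ⟨hcm.1, hcm.2.trans hx.2⟩ hcf) (by linarith [hcm.2] : c < xs).ne
  · refine mul_neg_of_neg_of_pos ?_ (sub_pos.2 hgt)
    by_contra! hcon
    obtain ⟨c, hcm, hcf⟩ := exists_mem_Icc_isFixedPt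
      (hc.mono (Icc_subset_Icc_left hx.1)) hx.2 (by linarith) (hφ 1 ⟨zero_le_one, le_rfl⟩).2
    exact absurd (h.2.2 c ⟨hx.1.trans hcm.1, hcm.2⟩ hcf) (by linarith [hcm.1] : xs < c).ne.symm

/-- A continuous function on `[0,1]` that is convex in the interior and negative at `1` has at most
one interior zero. -/
theorem not_two_zeros_of_convexOn {h : ℝ → ℝ} (hc : ContinuousOn h (Icc 0 1))
    (hconv : ConvexOn ℝ (Ioo 0 1) h) (h1 : h 1 < 0) {a b : ℝ} (ha : 0 < a) (hab : a < b)
    (hb : b < 1) (hza : h a = 0) (hzb : h b = 0) : False := by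
  -- Convexity is known only in the interior, so the negative value at `1` is first moved to some `c
  -- < 1`. The slope from `b` to `c` is then negative after a zero slope from `a` to `b`.
  have hev : ∀ᶠ c in 𝓝[<] (1 : ℝ), h c < 0 :=
    (((hc 1 ⟨zero_le_one, le_rfl⟩).mono_of_mem_nhdsWithin
      (mem_of_superset (Ioo_mem_nhdsLT zero_lt_one) Ioo_subset_Icc_self)).tendsto).eventually_lt_const
        h1
  obtain ⟨c, hcneg, hcb, hc1⟩ := (hev.and (Ioo_mem_nhdsLT hb)).exists
  have hs := hconv.slope_mono_adjacent ⟨ha, hab.trans hb⟩ ⟨(ha.trans hab).trans hcb, hc1⟩ hab hcb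
  rw [hza, hzb, sub_zero, sub_zero, zero_div] at hs
  exact absurd hs (not_le.2 (div_neg_of_neg_of_pos hcneg (sub_pos.2 hcb)))

/-- A continuous function on `[0,1]` that is concave in the interior and positive at `0` has at most
one interior zero. -/
theorem not_two_zeros_of_concaveOn {h : ℝ → ℝ} (hc : ContinuousOn h (Icc 0 1))
    (hconc : ConcaveOn ℝ (Ioo 0 1) h) (h0 : 0 < h 0) {a b : ℝ} (ha : 0 < a) (hab : a < b)
    (hb : b < 1) (hza : h a = 0) (hzb : h b = 0) : False := by
  have hev : ∀ᶠ c in 𝓝[>] (0 : ℝ), 0 < h c :=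
    (((hc 0 ⟨le_rfl, zero_le_one⟩).mono_of_mem_nhdsWithin
      (mem_of_superset (Ioo_mem_nhdsGT zero_lt_one) Ioo_subset_Icc_self)).tendsto).eventually_const_lt
        h0
  obtain ⟨c, hcpos, hc0, hca⟩ := (hev.and (Ioo_mem_nhdsGT ha)).exists
  have hs := hconc.slope_anti_adjacent ⟨hc0, (hca.trans hab).trans hb⟩ ⟨ha.trans hab, hb⟩ hca hab
  rw [hza, hzb, sub_zero, zero_div, zero_sub] at hs
  exact absurd hs (not_le.2 (div_neg_of_neg_of_pos (neg_neg_of_pos hcpos) (sub_pos.2 hca)))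

/-- The drift is `(2 * p - 1) * f` plus an affine function, so the sign of `2 * p - 1` decides
whether convexity and concavity are kept or exchanged. -/
theorem convexOn_or_concaveOn_drift {s : Set ℝ} {f : ℝ → ℝ} (p : ℝ)
    (hf : ConvexOn ℝ s f ∨ ConcaveOn ℝ s f) :
    ConvexOn ℝ s (fun x => g p f x - x) ∨ ConcaveOn ℝ s (fun x => g p f x - x) := by
  have hrepr : (fun x => g p f x - x) = fun x => (2 * p - 1) * f x + ((1 - p) - x) := by
    ext x; rw [g_eq]; ring
  rw [hrepr]
  have hs : Convex ℝ s := hf.elim And.left And.left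
  have hl : ConvexOn ℝ s fun x : ℝ => (1 - p) - x :=
    (convexOn_const (1 - p) hs).sub (concaveOn_id hs)
  have hl' : ConcaveOn ℝ s fun x : ℝ => (1 - p) - x :=
    (concaveOn_const (1 - p) hs).sub (convexOn_id hs)
  rcases le_total 0 (2 * p - 1) with h | h <;> rcases hf with hf | hf
  · exact Or.inl ((hf.smul h).add hl)
  · exact Or.inr ((hf.smul h).add hl')
  · refine Or.inr (((hf.smul (neg_nonneg.2 h)).neg.add hl').congr fun x _ => ?_)
    simp only [Pi.add_apply, Pi.neg_apply, smul_eq_mul]; ring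
  · refine Or.inl (((hf.smul (neg_nonneg.2 h)).neg.add hl).congr fun x _ => ?_)
    simp only [Pi.add_apply, Pi.neg_apply, smul_eq_mul]; ring

/-- Under each of the three shape conditions, `g` has at most one fixed point. -/
theorem fixedPoint_unique {p : ℝ} {f : ℝ → ℝ} (hp0 : 0 < p) (hp1 : p < 1)
    (hf : ∀ x ∈ Icc (0 : ℝ) 1, f x ∈ Icc (0 : ℝ) 1) (hfc : ContinuousOn f (Icc 0 1))
    (hG : CondG1 p f ∨ CondG2 f ∨ CondG3 p f) {a b : ℝ} (ha : a ∈ Icc (0 : ℝ) 1)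
    (hb : b ∈ Icc (0 : ℝ) 1) (hga : g p f a = a) (hgb : g p f b = b) : a = b := by
  wlog hab : a < b generalizing a b
  · rcases lt_trichotomy a b with h | h | h
    · exact absurd h hab
    · exact h
    · exact (this hb ha hgb hga h).symm
  exfalso
  have hga' := hga
  have hgb' := hgb
  rw [g_eq] at hga' hgb'
  rcases hG with ⟨-, ⟨h1, -, h2⟩ | ⟨-, h1, h2⟩⟩ | ⟨-, h⟩ | ⟨c, hc, hc1⟩
  -- In both monotone cases `g` is strictly decreasing, which is incompatible with `g a = a < b = g
  -- b`.
  · have h3 : f b < f a := h2 ha hb hab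
    have h4 := mul_pos (show 0 < 2 * p - 1 by linarith) (sub_pos.2 h3)
    linarith
  · have h3 : f a < f b := h2 ha hb hab
    have h4 := mul_pos (show 0 < 1 - 2 * p by linarith) (sub_pos.2 h3)
    linarith
  · have ha' := g_mem_unitInterval hp0 hp1 hf ha
    have hb' := g_mem_unitInterval hp0 hp1 hf hb
    rw [hga] at ha'
    rw [hgb] at hb'
    have hcont : ContinuousOn (fun x => g p f x - x) (Icc 0 1) :=
      (continuousOn_g hfc).sub continuousOn_id
    rcases convexOn_or_concaveOn_drift p (h.imp (·.convexOn) (·.concaveOn)) with h' | h'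
    · refine not_two_zeros_of_convexOn hcont h' ?_ ha'.1 hab hb'.2 (sub_eq_zero.2 hga)
        (sub_eq_zero.2 hgb)
      linarith [(g_mem_unitInterval hp0 hp1 hf (x := 1) ⟨zero_le_one, le_rfl⟩).2]
    · refine not_two_zeros_of_concaveOn hcont h' ?_ ha'.1 hab hb'.2 (sub_eq_zero.2 hga)
        (sub_eq_zero.2 hgb)
      linarith [(g_mem_unitInterval hp0 hp1 hf (x := 0) ⟨le_rfl, zero_le_one⟩).1]
  -- Contraction: `|b - a| ≤ c * |2 * p - 1| * |b - a| < |b - a|`.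
  · have h1 := hc b hb a ha
    have hpos : 0 < |b - a| := abs_pos.2 (sub_ne_zero.2 hab.ne')
    have h2 : b - a = (2 * p - 1) * (f b - f a) := by linarith
    have h3 : |b - a| = |2 * p - 1| * |f b - f a| := by rw [h2, abs_mul]
    have h4 := mul_le_mul_of_nonneg_left h1 (abs_nonneg (2 * p - 1))
    have h5 := mul_lt_mul_of_pos_right hc1 hpos
    linarith

end Elephant

/-! ### Assembly of the three conclusions -/

theorem theorem6 {Ω : Type*} {mΩ : MeasurableSpace Ω} (μ : Measure Ω) [IsProbabilityMeasure μ]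
    (p q : ℝ) (hp0 : 0 < p) (hp1 : p < 1) (hp : p ≠ 1 / 2) (hq : q ∈ Icc (0 : ℝ) 1)
    (f : ℝ → ℝ) (hf : ∀ x ∈ Icc (0 : ℝ) 1, f x ∈ Icc (0 : ℝ) 1)
    (k : ℕ → ℕ) (hk_pos : ∀ n, 1 ≤ n → 1 ≤ k n) (hk_le : ∀ n, 1 ≤ n → k n ≤ n)
    (hk_mono : ∀ m n, 1 ≤ m → m ≤ n → k m ≤ k n) (hk_top : Tendsto k atTop atTop)
    (ℱ : Filtration ℕ mΩ) (X : ℕ → Ω → ℝ) (U : (n : ℕ) → Ω → Fin (k n) → ℕ)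
    (hX : Elephant.IsWalkWithoutReplacement μ p q f k ℱ X U)
    (hF : ((Elephant.CondF1 f k ∨ Elephant.CondF3 f k) ∧ Elephant.CondSquares k) ∨
      (Elephant.CondF2 f k ∨ Elephant.CondF4 f k)) :
    (∀ xs : ℝ, Elephant.IsUniqueFixedPoint (Elephant.g p f) xs →
      (∀ x ∈ Icc (0 : ℝ) 1, x ≠ xs → (Elephant.g p f x - x) * (x - xs) < 0) →
      Elephant.ConvergesTo μ X xs) ∧
    (∀ xs : ℝ, Elephant.IsUniqueFixedPoint (Elephant.g p f) xs →
      Elephant.ConvergesTo μ X xs) ∧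
    ((Elephant.CondG1 p f ∨ Elephant.CondG2 f ∨ Elephant.CondG3 p f) →
      ∃ xs : ℝ, Elephant.IsUniqueFixedPoint (Elephant.g p f) xs ∧
        Elephant.ConvergesTo μ X xs) := by
  have hfc : ContinuousOn f (Icc 0 1) := by
    rcases hF with ⟨h | h, -⟩ | h | h
    · exact h.1
    · exact h.1.continuousOn
    · exact h.continuousOn
    · exact h.1.continuousOn
  have hgc : ContinuousOn (Elephant.g p f) (Icc 0 1) := Elephant.continuousOn_g hfc
  have hgm : ∀ x ∈ Icc (0 : ℝ) 1, Elephant.g p f x ∈ Icc (0 : ℝ) 1 := fun x hx =>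
    Ioo_subset_Icc_self (Elephant.g_mem_unitInterval hp0 hp1 hf hx)
  have hunique : ∀ xs : ℝ, Elephant.IsUniqueFixedPoint (Elephant.g p f) xs →
      Elephant.ConvergesTo μ X xs := fun xs hxs =>
    hX.convergesTo hp0 hp1 hq hf hk_le hk_top hgc fun x hx hne => hxs.drift_neg hgc hgm hx hne
  refine ⟨fun xs _ hsign => hX.convergesTo hp0 hp1 hq hf hk_le hk_top hgc hsign, hunique,
    fun hG => ?_⟩
  obtain ⟨xs, hxs, hfix⟩ := exists_mem_Icc_isFixedPt_of_mapsTo hgc zero_le_one hgm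
  have hu : Elephant.IsUniqueFixedPoint (Elephant.g p f) xs :=
    ⟨hxs, hfix, fun y hy hgy => Elephant.fixedPoint_unique hp0 hp1 hf hfc hG hy hxs hgy hfix⟩
  exact ⟨xs, hu, hunique xs hu⟩
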